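/- For $v>0$ let $A(v)=\int_0^\infty\left(\frac{1}{xv}-\frac{1}{e^{xv}-1}\right)\left(\frac1x-\frac{1}{e^x-1}\right)dx$, and let $C=\frac{\log(2\pi)-\gamma}{2}$, where $\gamma$ is Euler's constant. The integral converges absolutely for every $v>0$, the function $A$ is infinitely differentiable on $(0,\infty)$, and for every integer $k\ge 0$, $$A^{(k)}(1)=(-1)^k\,k!\left((1+\delta_{k,0})\,C-\frac{1}{2(k+1)}-\frac{H_{k-1}}{2}+\sum_{j=2}^{k}\binom{k}{j-1}\frac{\zeta(j)B_j}{j}\right).$$ Here $\delta_{k,0}$ is the Kronecker symbol, $H_n=\sum_{j=1}^n\frac1j$ for $n\ge1$ with the convention $H_{-1}=H_0=0$, $\zeta$ is the Riemann zeta function, $B_j$ are the Bernoulli numbers defined by $\frac{t}{e^t-1}=\sum_{n\ge0}B_n\frac{t^n}{n!}$ for $|t|<2\pi$, and the sum over $j$ is empty for $k\le1$. In particular, $A(1)=2C-\frac12$. -/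

import Mathlib

open scoped ContDiff

noncomputable section

/-- The integrand `(1/(xv) - 1/(e^{xv} - 1)) * (1/x - 1/(e^x - 1))`. -/
def autoCorrIntegrand (v x : ℝ) : ℝ :=
  (1 / (x * v) - 1 / (Real.exp (x * v) - 1)) * (1 / x - 1 / (Real.exp x - 1))

/-- The exponential auto-correlation function `A(v)`, for `v > 0`. -/
def autoCorr (v : ℝ) : ℝ :=
  ∫ x in Set.Ioi (0 : ℝ), autoCorrIntegrand v x

/-- The constant `C = (log (2π) - γ) / 2`. -/
def constC : ℝ :=
  (Real.log (2 * Real.pi) - Real.eulerMascheroniConstant) / 2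

end

/-! ### The Bose function and its derivatives. -/

section

open Filter Topology Set MeasureTheory Polynomial

/-! Write b for the Bose function and φ = 1/x - b. Differentiating under the integral gives A^(k)(1)
= ∫ x^k φ^(k) φ. The nonlinear part b·b^(k) of the expanded product is linear in the derivatives
b^(1), ..., b^(k+1), with Bernoulli coefficients (`bose_mul_boseDeriv`): this is the addition
formula b(x)b(x+t) = b(t)(b(x) - b(x+t)) - b(x+t), expanded in t. Integration by parts lowers x^k
b^(m) to a multiple of x^(k-m) b. For m < k the Mellin transform of b yields the zeta values. For m
= k the divergent ∫ b/2 joins 1/x² - b/x to form `constIntegrand`, whose integral C comes from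
Stirling's formula and H_N - log N → γ (`integral_constIntegrand`). The boundary terms at 0 supply
the rational part (`tendsto_boundaryTerm_zero`). For k = 0 the identity φ² = 2·`constIntegrand` + φ'
suffices. -/

/-- The Bose function `1 / (e^x - 1)`. -/
noncomputable def bose (x : ℝ) : ℝ := 1 / (Real.exp x - 1)

/-- The polynomials expressing the derivatives of `bose` in terms of `bose`. -/
noncomputable def bosePoly : ℕ → ℝ[X]
  | 0 => X
  | k + 1 => -(X + X ^ 2) * derivative (bosePoly k)

/-- The `k`-th derivative of `bose` on the positive half-line. -/
noncomputable def boseDeriv (k : ℕ) (x : ℝ) : ℝ := (bosePoly k).eval (bose x)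

/-- The `k`-th derivative of `1 / x - 1 / (e^x - 1)` on the positive half-line. -/
noncomputable def phiDeriv (k : ℕ) (x : ℝ) : ℝ :=
  (-1) ^ k * k.factorial / x ^ (k + 1) - boseDeriv k x

lemma boseDeriv_zero : boseDeriv 0 = bose := by
  funext x; simp [boseDeriv, bosePoly]

lemma phiDeriv_zero (x : ℝ) : phiDeriv 0 x = 1 / x - bose x := by
  simp [phiDeriv, boseDeriv_zero]

lemma exp_sub_one_pos {x : ℝ} (hx : 0 < x) : 0 < Real.exp x - 1 := by
  have := Real.add_one_lt_exp hx.ne'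
  linarith

lemma bose_pos {x : ℝ} (hx : 0 < x) : 0 < bose x :=
  one_div_pos.2 (exp_sub_one_pos hx)

lemma hasDerivAt_bose {x : ℝ} (hx : 0 < x) :
    HasDerivAt bose (-(bose x + bose x ^ 2)) x := by
  have h := exp_sub_one_pos hx
  have h1 := ((Real.hasDerivAt_exp x).sub_const 1).inv h.ne'
  have h2 : bose = (fun y => Real.exp y - 1)⁻¹ := by funext y; simp [bose]
  rw [h2]
  convert! h1 using 1
  simp only [Pi.inv_apply]
  field_simp
  ring

lemma hasDerivAt_boseDeriv (k : ℕ) {x : ℝ} (hx : 0 < x) :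
    HasDerivAt (boseDeriv k) (boseDeriv (k + 1) x) x := by
  have h := ((bosePoly k).hasDerivAt (bose x)).comp x (hasDerivAt_bose hx)
  convert! h using 1
  simp [boseDeriv, bosePoly]
  ring

lemma hasDerivAt_phiDeriv (k : ℕ) {x : ℝ} (hx : 0 < x) :
    HasDerivAt (phiDeriv k) (phiDeriv (k + 1) x) x := by
  have h1 : HasDerivAt (fun y : ℝ => (-1 : ℝ) ^ k * k.factorial / y ^ (k + 1))
      ((-1 : ℝ) ^ (k + 1) * (k + 1).factorial / x ^ (k + 1 + 1)) x := by
    have := (((hasDerivAt_pow (k + 1) x).inv (by positivity)).const_mul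
      ((-1 : ℝ) ^ k * k.factorial))
    convert! this using 1
    rw [Nat.factorial_succ]
    push_cast
    field_simp
    ring
  exact h1.sub (hasDerivAt_boseDeriv k hx)

/-! ### Linearising the product of b with its derivatives. -/

lemma X_dvd_bosePoly (k : ℕ) : X ∣ bosePoly k := by
  cases k with
  | zero => exact dvd_rfl
  | succ k => exact ⟨-(1 + X) * derivative (bosePoly k), by simp only [bosePoly]; ring⟩

/-- Differentiate b·e^x = 1 + b exactly k + 1 times by Leibniz, then multiply by b and replace b·e^x
by 1 + b. Here D = -(X + X²) d/dX plays the role of d/dx. -/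
lemma bosePoly_leibniz (k : ℕ) :
    (1 + X) * ∑ i ∈ Finset.range (k + 2), ((k + 1).choose i : ℝ[X]) * bosePoly i
      = X * bosePoly (k + 1) := by
  -- Pascal's rule: the binomial sums satisfy S_(n+1) = (1 + D) S_n.
  have key : ∀ n : ℕ, ∑ i ∈ Finset.range (n + 2), ((n + 1).choose i : ℝ[X]) * bosePoly i
      = ∑ i ∈ Finset.range (n + 1), (n.choose i : ℝ[X]) * bosePoly i
        + -(X + X ^ 2) * derivative
          (∑ i ∈ Finset.range (n + 1), (n.choose i : ℝ[X]) * bosePoly i) := by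
    intro n
    have h1 : -(X + X ^ 2) * derivative
          (∑ i ∈ Finset.range (n + 1), (n.choose i : ℝ[X]) * bosePoly i)
        = ∑ i ∈ Finset.range (n + 1), (n.choose i : ℝ[X]) * bosePoly (i + 1) := by
      rw [derivative_sum, Finset.mul_sum]
      refine Finset.sum_congr rfl fun i _ => ?_
      rw [derivative_natCast_mul]
      simp only [bosePoly]
      ring
    rw [h1, Finset.sum_range_succ']
    simp only [Nat.choose_succ_succ, Nat.cast_add, add_mul, Finset.sum_add_distrib]
    have h2 : ∑ i ∈ Finset.range (n + 1), (n.choose i : ℝ[X]) * bosePoly i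
        = ∑ i ∈ Finset.range (n + 1), (n.choose (i + 1) : ℝ[X]) * bosePoly (i + 1)
          + bosePoly 0 := by
      rw [Finset.sum_range_succ', Finset.sum_range_succ _ n]
      simp
    rw [h2]
    simp
    ring
  induction k with
  | zero =>
    simp [Finset.sum_range_succ, bosePoly]
    ring
  | succ k ih =>
    rw [key (k + 1)]
    set S := ∑ i ∈ Finset.range (k + 1 + 1), ((k + 1).choose i : ℝ[X]) * bosePoly i with hS
    have hd := congrArg derivative ih
    simp only [derivative_mul, derivative_add, derivative_one, derivative_X] at hd
    have h3 : bosePoly (k + 1 + 1) = -(X + X ^ 2) * derivative (bosePoly (k + 1)) := rfl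
    rw [h3]
    linear_combination (-(X + X ^ 2)) * hd + (1 + X) * ih

/-- The exponential generating function of the derivatives of `bose` at `x`. -/
noncomputable def boseSeries (x : ℝ) : PowerSeries ℝ :=
  PowerSeries.mk fun m => boseDeriv m x / m.factorial

/-- Formally the series is b(x + t) = 1/(e^x e^t - 1), and e^x = (1 + b)/b. Coefficientwise this is
the Leibniz identity, so no convergence is needed. -/
lemma boseSeries_mul_exp (x : ℝ) :
    boseSeries x * ((1 + PowerSeries.C (bose x)) * PowerSeries.exp ℝ - PowerSeries.C (bose x))
      = PowerSeries.C (bose x) := by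
  have h : boseSeries x * ((1 + PowerSeries.C (bose x)) * PowerSeries.exp ℝ
        - PowerSeries.C (bose x))
      = PowerSeries.C (1 + bose x) * (boseSeries x * PowerSeries.exp ℝ)
        - PowerSeries.C (bose x) * boseSeries x := by
    simp; ring
  rw [h]
  ext k
  rw [map_sub, PowerSeries.coeff_C_mul, PowerSeries.coeff_C_mul, PowerSeries.coeff_mul,
    PowerSeries.coeff_C]
  have h2 : ∑ p ∈ Finset.HasAntidiagonal.antidiagonal k, PowerSeries.coeff p.1 (boseSeries x)
        * PowerSeries.coeff p.2 (PowerSeries.exp ℝ)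
      = (∑ i ∈ Finset.range (k + 1), (k.choose i : ℝ) * boseDeriv i x) / k.factorial := by
    rw [Finset.Nat.sum_antidiagonal_eq_sum_range_succ_mk, Finset.sum_div]
    refine Finset.sum_congr rfl fun i hi => ?_
    have hi' : i ≤ k := Nat.lt_succ_iff.1 (Finset.mem_range.1 hi)
    rw [Nat.cast_choose ℝ hi']
    simp only [boseSeries, PowerSeries.coeff_mk, PowerSeries.coeff_exp]
    simp
    field_simp
  rw [h2]
  cases k with
  | zero => simp [boseSeries, boseDeriv_zero]; ring
  | succ k =>
    have h3 := congrArg (Polynomial.eval (bose x)) (bosePoly_leibniz k)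
    simp [eval_finsetSum] at h3
    simp only [boseSeries, PowerSeries.coeff_mk]
    simp
    rw [mul_div_assoc', mul_div_assoc', ← sub_div, div_eq_zero_iff]
    left
    simp only [boseDeriv]
    linarith

/-- The addition formula for b, multiplied by t: e^t is eliminated using B(t)(e^t - 1) = t. -/
lemma boseSeries_bernoulli (x : ℝ) :
    PowerSeries.C (bose x) * boseSeries x * PowerSeries.X
      = bernoulliPowerSeries ℝ * (PowerSeries.C (bose x) - boseSeries x)
        - PowerSeries.X * boseSeries x := by
  have h1 := boseSeries_mul_exp x
  have h2 := bernoulliPowerSeries_mul_exp_sub_one ℝ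
  linear_combination (bernoulliPowerSeries ℝ) * h1 -
    (boseSeries x + PowerSeries.C (bose x) * boseSeries x) * h2

/-- The coefficient of `boseDeriv m` in the expansion of `bose * boseDeriv k`. -/
noncomputable def boseCoeff (k m : ℕ) : ℝ :=
  k.factorial * ((bernoulli (k + 1 - m) : ℚ) : ℝ) / (m.factorial * (k + 1 - m).factorial)

lemma bose_mul_boseDeriv (k : ℕ) (x : ℝ) :
    bose x * boseDeriv k x
      = -boseDeriv k x - ∑ m ∈ Finset.Icc 1 (k + 1), boseCoeff k m * boseDeriv m x := by
  have h := congrArg (PowerSeries.coeff (k + 1)) (boseSeries_bernoulli x)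
  rw [map_sub, PowerSeries.coeff_succ_mul_X, PowerSeries.coeff_C_mul, PowerSeries.coeff_succ_X_mul,
    mul_comm (bernoulliPowerSeries ℝ), PowerSeries.coeff_mul,
    Finset.Nat.sum_antidiagonal_eq_sum_range_succ_mk, Finset.sum_range_succ'] at h
  -- The constant terms cancel, so the expansion starts at m = 1.
  have h0 : PowerSeries.coeff 0 (PowerSeries.C (bose x) - boseSeries x) = 0 := by
    simp [boseSeries, boseDeriv_zero]
  simp only [h0, zero_mul, add_zero] at h
  have hk : (k.factorial : ℝ) ≠ 0 := by positivity
  have h4 : ∑ m ∈ Finset.Icc 1 (k + 1), boseCoeff k m * boseDeriv m x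
      = -(k.factorial : ℝ) * ∑ i ∈ Finset.range (k + 1),
        PowerSeries.coeff (i + 1) (PowerSeries.C (bose x) - boseSeries x) *
          PowerSeries.coeff (k + 1 - (i + 1)) (bernoulliPowerSeries ℝ) := by
    rw [Finset.range_eq_Ico, Finset.sum_Ico_add' (fun i => PowerSeries.coeff i
      (PowerSeries.C (bose x) - boseSeries x) *
          PowerSeries.coeff (k + 1 - i) (bernoulliPowerSeries ℝ)) 0 (k + 1) 1, Finset.mul_sum]
    refine Finset.sum_congr (by ext; simp) fun m hm => ?_
    have hm' : m ≠ 0 := by simp at hm; omega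
    simp [boseCoeff, boseSeries, bernoulliPowerSeries, PowerSeries.coeff_C, hm']
    field_simp
  rw [h4]
  simp only [boseSeries, PowerSeries.coeff_mk] at h ⊢
  field_simp at h
  linarith

/-! ### Decay at infinity and regularity at the origin. -/

lemma bose_le_factorial_div_pow {n : ℕ} (hn : n ≠ 0) {x : ℝ} (hx : 0 < x) :
    bose x ≤ n.factorial / x ^ n := by
  have h1 := Real.sum_le_exp_of_nonneg hx.le (n + 1)
  rw [Finset.sum_range_succ] at h1
  have h2 : (1 : ℝ) ≤ ∑ i ∈ Finset.range n, x ^ i / i.factorial := by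
    have := Finset.single_le_sum (f := fun i => x ^ i / (i.factorial : ℝ))
      (fun i _ => by positivity) (Finset.mem_range.2 (Nat.pos_of_ne_zero hn))
    simpa using this
  have h3 : x ^ n / n.factorial ≤ Real.exp x - 1 := by linarith
  have h4 : 0 < x ^ n / n.factorial := by positivity
  calc bose x ≤ 1 / (x ^ n / n.factorial) := one_div_le_one_div_of_le h4 h3
    _ = _ := by rw [one_div_div]

lemma exists_boseDeriv_le_bose (k : ℕ) :
    ∃ C, 0 ≤ C ∧ ∀ x : ℝ, 1 ≤ x → |boseDeriv k x| ≤ C * bose x := by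
  obtain ⟨Q, hQ⟩ := X_dvd_bosePoly k
  obtain ⟨C, hC⟩ := (isCompact_Icc (a := (0 : ℝ)) (b := 1)).exists_bound_of_continuousOn
    (f := fun y => Q.eval y) Q.continuous.continuousOn
  refine ⟨C, (norm_nonneg _).trans (hC 0 (by simp)), fun x hx => ?_⟩
  have hx0 : 0 < x := by linarith
  have hb := bose_pos hx0
  have hb1 : bose x ≤ 1 := by
    have := bose_le_factorial_div_pow one_ne_zero hx0
    simp only [Nat.factorial_one, Nat.cast_one, pow_one] at this
    exact this.trans ((div_le_one hx0).2 hx)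
  have := hC (bose x) ⟨hb.le, hb1⟩
  rw [boseDeriv, hQ, eval_mul, eval_X, abs_mul, abs_of_pos hb, mul_comm]
  exact mul_le_mul_of_nonneg_right this hb.le

lemma exists_boseDeriv_bound (k n : ℕ) :
    ∃ C, 0 ≤ C ∧ ∀ x : ℝ, 1 ≤ x → |boseDeriv k x| ≤ C / x ^ n := by
  obtain ⟨C, hC0, hC⟩ := exists_boseDeriv_le_bose k
  refine ⟨C * (n + 1).factorial, by positivity, fun x hx => (hC x hx).trans ?_⟩
  have hx0 : 0 < x := by linarith
  rw [mul_div_assoc]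
  refine mul_le_mul_of_nonneg_left ((bose_le_factorial_div_pow (Nat.succ_ne_zero n) hx0).trans ?_)
    hC0
  gcongr
  exact n.le_succ

lemma AnalyticAt.dslope_of_forall {f : ℝ → ℝ} (hf : ∀ x, AnalyticAt ℝ f x) (a x : ℝ) :
    AnalyticAt ℝ (dslope f a) x := by
  rcases eq_or_ne x a with rfl | h
  · obtain ⟨p, hp⟩ := hf x
    exact ⟨_, hp.has_fpower_series_dslope_fslope⟩
  · have h1 : AnalyticAt ℝ (fun y => (f y - f a) / (y - a)) x :=
      ((hf x).sub analyticAt_const).div (analyticAt_id.sub analyticAt_const) (sub_ne_zero.2 h)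
    refine h1.congr ?_
    filter_upwards [dslope_eventuallyEq_slope_of_ne f h] with y hy
    rw [hy, slope_def_field]

/-- `1 / x - 1 / (e^x - 1)` extends analytically across the origin, with value `1 / 2` there. -/
lemma exists_analytic_extension_phi :
    ∃ ψ : ℝ → ℝ, (∀ x, AnalyticAt ℝ ψ x) ∧ ψ 0 = 1 / 2 ∧ ∀ x, 0 < x → ψ x = phiDeriv 0 x := by
  -- The extension is the quotient of (e^x - 1 - x)/x² by (e^x - 1)/x, both entire; the latter never
  -- vanishes on ℝ.
  have ha : ∀ x, AnalyticAt ℝ (dslope Real.exp 0) x :=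
    AnalyticAt.dslope_of_forall (fun x => analyticAt_rexp) 0
  have hb : ∀ x, AnalyticAt ℝ (dslope (dslope Real.exp 0) 0) x :=
    AnalyticAt.dslope_of_forall ha 0
  have h0 : dslope Real.exp 0 0 = 1 := by simp
  have h1 : ∀ x, x ≠ 0 → dslope Real.exp 0 x = (Real.exp x - 1) / x := fun x hx => by
    rw [dslope_of_ne _ hx, slope_def_field]; simp
  have h2 : ∀ x, x ≠ 0 → dslope (dslope Real.exp 0) 0 x = ((Real.exp x - 1) / x - 1) / x :=
    fun x hx => by
      rw [dslope_of_ne _ hx, slope_def_field, h0, h1 x hx]; simp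
  have hne : ∀ x : ℝ, x ≠ 0 → Real.exp x - 1 ≠ 0 := fun x hx => by
    rw [sub_ne_zero]; simpa using hx
  have hpos : ∀ x, dslope Real.exp 0 x ≠ 0 := fun x => by
    rcases eq_or_ne x 0 with rfl | hx
    · rw [h0]; exact one_ne_zero
    · rw [h1 x hx]; exact div_ne_zero (hne x hx) hx
  have hψ : ∀ x, x ≠ 0 → dslope (dslope Real.exp 0) 0 x / dslope Real.exp 0 x
      = 1 / x - 1 / (Real.exp x - 1) := fun x hx => by
    rw [h1 x hx, h2 x hx]
    have := hne x hx
    field_simp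
  refine ⟨fun x => dslope (dslope Real.exp 0) 0 x / dslope Real.exp 0 x,
    fun x => (hb x).div (ha x) (hpos x), ?_, fun x hx => ?_⟩
  · set ψ : ℝ → ℝ := fun x => dslope (dslope Real.exp 0) 0 x / dslope Real.exp 0 x with hdef
    have hc : Continuous ψ :=
      continuous_iff_continuousAt.2 fun x => ((hb x).div (ha x) (hpos x)).continuousAt
    have hs : Continuous fun x => ψ x + ψ (-x) := by fun_prop
    have h3 : Tendsto (fun x => ψ x + ψ (-x)) (𝓝[≠] 0) (𝓝 (ψ 0 + ψ (-0))) :=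
      (hs.tendsto 0).mono_left nhdsWithin_le_nhds
    -- ψ(x) + ψ(-x) = 1 off the origin, so continuity forces ψ(0) = 1/2.
    have h4 : Tendsto (fun x => ψ x + ψ (-x)) (𝓝[≠] 0) (𝓝 1) := by
      refine tendsto_const_nhds.congr' ?_
      filter_upwards [self_mem_nhdsWithin] with x hx
      have hx' : x ≠ 0 := hx
      have hx2 : -x ≠ 0 := neg_ne_zero.2 hx'
      have e1 := hne x hx'
      have e2 := hne (-x) hx2
      simp only [hdef]
      rw [hψ x hx', hψ (-x) hx2]
      rw [Real.exp_neg] at e2 ⊢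
      have e3 : 1 - Real.exp x ≠ 0 := fun h => e1 (by linarith)
      have e4 : (Real.exp x)⁻¹ - 1 = (1 - Real.exp x) / Real.exp x := by
        field_simp
      rw [e4]
      have e5 : 1 - Real.exp x = -(Real.exp x - 1) := by ring
      rw [e5]
      field_simp
      ring
    have := tendsto_nhds_unique h3 h4
    simp only [neg_zero] at this
    linarith
  · rw [phiDeriv_zero, bose, ← hψ x hx.ne']

lemma iteratedDeriv_eq_of_hasDerivAt {f : ℕ → ℝ → ℝ} {g : ℝ → ℝ}
    (hg : ∀ x, 0 < x → g x = f 0 x)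
    (hf : ∀ k x, 0 < x → HasDerivAt (f k) (f (k + 1) x) x) (k : ℕ) :
    ∀ x, 0 < x → iteratedDeriv k g x = f k x := by
  induction k with
  | zero => simpa using hg
  | succ k ih =>
    intro x hx
    rw [iteratedDeriv_succ]
    have : iteratedDeriv k g =ᶠ[𝓝 x] f k := by
      filter_upwards [Ioi_mem_nhds hx] with y hy using ih y hy
    rw [this.deriv_eq, (hf k x hx).deriv]

lemma exists_phiDeriv_bound_Ioc (k : ℕ) :
    ∃ C, 0 ≤ C ∧ ∀ x : ℝ, 0 < x → x ≤ 1 → |phiDeriv k x| ≤ C := by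
  obtain ⟨ψ, hψ, -, hψ1⟩ := exists_analytic_extension_phi
  have hc : ContDiff ℝ k ψ :=
    AnalyticOnNhd.contDiff (fun x _ => hψ x)
  obtain ⟨C, hC⟩ := (isCompact_Icc (a := (0 : ℝ)) (b := 1)).exists_bound_of_continuousOn
    (f := iteratedDeriv k ψ) (hc.continuous_iteratedDeriv k le_rfl).continuousOn
  refine ⟨C, (norm_nonneg _).trans (hC 0 (by simp)), fun x hx hx1 => ?_⟩
  rw [← iteratedDeriv_eq_of_hasDerivAt hψ1 (fun k x hx => hasDerivAt_phiDeriv k hx) k x hx]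
  exact hC x ⟨hx.le, hx1⟩

/-- Near 0 the analytic extension controls φ^(k); at infinity the power x^(-k-1) dominates. The
exponent makes x^k φ^(k)(xv) φ(x) of order (1 + x)^(-2). -/
lemma exists_phiDeriv_bound (k : ℕ) :
    ∃ C, 0 ≤ C ∧ ∀ x : ℝ, 0 < x → |phiDeriv k x| ≤ C / (1 + x) ^ (k + 1) := by
  obtain ⟨C₁, hC₁, h1⟩ := exists_phiDeriv_bound_Ioc k
  obtain ⟨C₂, hC₂, h2⟩ := exists_boseDeriv_bound k (k + 1)
  refine ⟨(C₁ + (k.factorial + C₂)) * 2 ^ (k + 1), by positivity, fun x hx => ?_⟩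
  rcases le_total x 1 with hx1 | hx1
  · have h3 : (1 + x) ^ (k + 1) ≤ 2 ^ (k + 1) := by gcongr; linarith
    rw [le_div_iff₀ (by positivity)]
    have h4 : C₁ ≤ C₁ + (k.factorial + C₂) := by linarith [(by positivity : (0:ℝ) ≤ k.factorial)]
    exact mul_le_mul ((h1 x hx hx1).trans h4) h3 (by positivity) (by positivity)
  · have h3 : (1 + x) ^ (k + 1) ≤ 2 ^ (k + 1) * x ^ (k + 1) := by
      rw [← mul_pow]; gcongr; linarith
    have h4 : |phiDeriv k x| ≤ (k.factorial + C₂) / x ^ (k + 1) := by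
      rw [phiDeriv, add_div]
      refine (abs_sub _ _).trans (add_le_add ?_ (h2 x hx1))
      simp [abs_div, abs_mul, abs_of_pos hx]
    refine h4.trans ?_
    rw [div_le_div_iff₀ (by positivity) (by positivity)]
    calc (k.factorial + C₂) * (1 + x) ^ (k + 1)
        ≤ (C₁ + (k.factorial + C₂)) * (2 ^ (k + 1) * x ^ (k + 1)) := by
          refine mul_le_mul (by linarith) h3 (by positivity) (by positivity)
      _ = _ := by ring

/-! ### Differentiation under the integral sign. -/

lemma integrableOn_one_add_sq_inv (C : ℝ) :
    IntegrableOn (fun x : ℝ => C / (1 + x) ^ 2) (Ioi 0) := by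
  have h : IntegrableOn (fun x : ℝ => 1 / (1 + x) ^ 2) (Ioi 0) := by
    refine integrableOn_Ioi_deriv_of_nonneg' (g := fun x : ℝ => -(1 + x)⁻¹) (l := -0)
      (fun x hx => ?_) (fun x hx => by positivity) ?_
    · have hx : 0 ≤ x := hx
      have := (((hasDerivAt_id x).const_add 1).inv (by simp only [id]; positivity)).neg
      convert! this using 1
      simp only [id]
      field_simp
    · exact (tendsto_inv_atTop_zero.comp (tendsto_atTop_add_const_left _ 1 tendsto_id)).neg
  simpa [div_eq_mul_inv, IntegrableOn] using h.const_mul C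

lemma integrableOn_Ioi_of_le_one_add_sq {f : ℝ → ℝ} {C : ℝ} (hc : ContinuousOn f (Ioi 0))
    (hf : ∀ x, 0 < x → |f x| ≤ C / (1 + x) ^ 2) : IntegrableOn f (Ioi 0) :=
  Integrable.mono' (integrableOn_one_add_sq_inv C)
    (hc.aestronglyMeasurable measurableSet_Ioi)
    ((ae_restrict_iff' measurableSet_Ioi).2 (Eventually.of_forall hf))

lemma continuousOn_phiDeriv (k : ℕ) : ContinuousOn (phiDeriv k) (Ioi 0) :=
  fun _ hx => (hasDerivAt_phiDeriv k hx).continuousAt.continuousWithinAt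

lemma continuousOn_bose : ContinuousOn bose (Ioi 0) :=
  fun _ hx => (hasDerivAt_bose hx).continuousAt.continuousWithinAt

/-- The `k`-th derivative in `v` of `autoCorrIntegrand v x`. -/
noncomputable def autoCorrIntegrandDeriv (k : ℕ) (v x : ℝ) : ℝ :=
  x ^ k * phiDeriv k (x * v) * phiDeriv 0 x

lemma autoCorrIntegrand_eq (v x : ℝ) :
    autoCorrIntegrand v x = autoCorrIntegrandDeriv 0 v x := by
  simp [autoCorrIntegrandDeriv, autoCorrIntegrand, phiDeriv_zero, bose]

lemma continuousOn_autoCorrIntegrandDeriv (k : ℕ) {v : ℝ} (hv : 0 < v) :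
    ContinuousOn (autoCorrIntegrandDeriv k v) (Ioi 0) := by
  refine ((continuousOn_id.pow k).mul ((continuousOn_phiDeriv k).comp
    (continuousOn_id.mul continuousOn_const) fun x hx => ?_)).mul (continuousOn_phiDeriv 0)
  exact mul_pos hx hv

lemma exists_autoCorrIntegrandDeriv_bound (k : ℕ) {a : ℝ} (ha : 0 < a) :
    ∃ C, ∀ v, a ≤ v → ∀ x, 0 < x → |autoCorrIntegrandDeriv k v x| ≤ C / (1 + x) ^ 2 := by
  obtain ⟨C₀, hC₀, h0⟩ := exists_phiDeriv_bound 0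
  obtain ⟨C, hC, h1⟩ := exists_phiDeriv_bound k
  -- This m gives m(1 + x) ≤ 1 + xv for all v ≥ a, hence a majorant uniform in v.
  set m := min a 1 with hm
  have hm0 : 0 < m := lt_min ha one_pos
  refine ⟨C / m ^ (k + 1) * C₀, fun v hv x hx => ?_⟩
  have hv0 : 0 < v := ha.trans_le hv
  have h2 : m * (1 + x) ≤ 1 + x * v := by
    have := min_le_left a 1
    have := min_le_right a 1
    nlinarith
  have h3 : |x ^ k * phiDeriv k (x * v)| ≤ C / m ^ (k + 1) / (1 + x) := by
    rw [abs_mul, abs_of_pos (by positivity : 0 < x ^ k)]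
    calc x ^ k * |phiDeriv k (x * v)| ≤ x ^ k * (C / (1 + x * v) ^ (k + 1)) := by
          gcongr; exact h1 _ (by positivity)
      _ ≤ (1 + x) ^ k * (C / (m * (1 + x)) ^ (k + 1)) := by
          gcongr; linarith
      _ = _ := by rw [mul_pow]; field_simp; ring
  rw [autoCorrIntegrandDeriv, abs_mul]
  calc _ ≤ C / m ^ (k + 1) / (1 + x) * (C₀ / (1 + x) ^ (0 + 1)) := by
        gcongr
        exact h0 x hx
    _ = _ := by field_simp; try ring

lemma integrableOn_autoCorrIntegrandDeriv (k : ℕ) {v : ℝ} (hv : 0 < v) :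
    IntegrableOn (autoCorrIntegrandDeriv k v) (Ioi 0) := by
  obtain ⟨C, hC⟩ := exists_autoCorrIntegrandDeriv_bound k hv
  exact integrableOn_Ioi_of_le_one_add_sq (continuousOn_autoCorrIntegrandDeriv k hv) (hC v le_rfl)

/-- The `k`-th derivative of `autoCorr` on the positive half-line. -/
noncomputable def autoCorrDeriv (k : ℕ) (v : ℝ) : ℝ :=
  ∫ x in Ioi (0 : ℝ), autoCorrIntegrandDeriv k v x

lemma autoCorr_eq : autoCorr = autoCorrDeriv 0 := by
  funext v
  simp only [autoCorr, autoCorrDeriv, autoCorrIntegrand_eq]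

lemma hasDerivAt_autoCorrDeriv (k : ℕ) {v : ℝ} (hv : 0 < v) :
    HasDerivAt (autoCorrDeriv k) (autoCorrDeriv (k + 1) v) v := by
  obtain ⟨C, hC⟩ := exists_autoCorrIntegrandDeriv_bound (k + 1) (half_pos hv)
  refine (hasDerivAt_integral_of_dominated_loc_of_deriv_le (s := Ioi (v / 2))
    (μ := volume.restrict (Ioi 0)) (F := autoCorrIntegrandDeriv k)
    (F' := autoCorrIntegrandDeriv (k + 1)) (bound := fun x => C / (1 + x) ^ 2)
    (Ioi_mem_nhds (by linarith)) ?_ (integrableOn_autoCorrIntegrandDeriv k hv)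
    ((continuousOn_autoCorrIntegrandDeriv (k + 1) hv).aestronglyMeasurable measurableSet_Ioi)
    ((ae_restrict_iff' measurableSet_Ioi).2 (Eventually.of_forall fun x hx w hw =>
      hC w (le_of_lt hw) x hx))
    (integrableOn_one_add_sq_inv C)
    ((ae_restrict_iff' measurableSet_Ioi).2 (Eventually.of_forall fun x hx w hw => ?_))).2
  · filter_upwards [Ioi_mem_nhds hv] with w hw
    exact (continuousOn_autoCorrIntegrandDeriv k hw).aestronglyMeasurable measurableSet_Ioi
  · have hx : 0 < x := hx
    have hw : v / 2 < w := hw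
    have hxw : 0 < x * w := mul_pos hx (by linarith)
    have h := (hasDerivAt_phiDeriv k hxw).comp w ((hasDerivAt_id w).const_mul x)
    have h2 := (h.const_mul (x ^ k)).mul_const (phiDeriv 0 x)
    convert! h2 using 1
    simp only [autoCorrIntegrandDeriv, mul_one]
    ring

lemma contDiffOn_autoCorrDeriv (n : ℕ) (k : ℕ) :
    ContDiffOn ℝ n (autoCorrDeriv k) (Ioi 0) := by
  induction n generalizing k with
  | zero =>
    exact contDiffOn_zero.2 fun v hv => (hasDerivAt_autoCorrDeriv k hv).continuousAt.continuousWithinAt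
  | succ n ih =>
    push_cast
    rw [contDiffOn_succ_iff_deriv_of_isOpen isOpen_Ioi]
    refine ⟨fun v hv => (hasDerivAt_autoCorrDeriv k hv).differentiableAt.differentiableWithinAt,
      by simp, (ih (k + 1)).congr fun v hv => (hasDerivAt_autoCorrDeriv k hv).deriv⟩

lemma iteratedDeriv_autoCorr (k : ℕ) {v : ℝ} (hv : 0 < v) :
    iteratedDeriv k autoCorr v = autoCorrDeriv k v :=
  iteratedDeriv_eq_of_hasDerivAt (fun v _ => by rw [autoCorr_eq])
    (fun k _ hx => hasDerivAt_autoCorrDeriv k hx) k v hv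

end

/-! ### The Mellin transform of b. -/

section

open Filter Topology Set MeasureTheory

lemma integrableOn_Ioi_of_bounds {f : ℝ → ℝ} {A B : ℝ} (hc : ContinuousOn f (Ioi 0))
    (h0 : ∀ x, 0 < x → x ≤ 1 → |f x| ≤ A) (h1 : ∀ x, 1 ≤ x → |f x| ≤ B / x ^ 2) :
    IntegrableOn f (Ioi 0) := by
  have hA : 0 ≤ A := (abs_nonneg _).trans (h0 1 one_pos le_rfl)
  have hB : 0 ≤ B := by simpa using (abs_nonneg _).trans (h1 1 le_rfl)
  refine integrableOn_Ioi_of_le_one_add_sq (C := (A + B) * 4) hc fun x hx => ?_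
  rw [le_div_iff₀ (by positivity)]
  rcases le_total x 1 with h | h
  · have : (1 + x) ^ 2 ≤ 4 := by nlinarith
    exact mul_le_mul ((h0 x hx h).trans (by linarith)) this (by positivity) (by positivity)
  · have h2 : (1 + x) ^ 2 ≤ x ^ 2 * 4 := by nlinarith
    calc |f x| * (1 + x) ^ 2 ≤ B / x ^ 2 * (x ^ 2 * 4) :=
          mul_le_mul (h1 x h) h2 (by positivity) (by positivity)
      _ = B * 4 := by field_simp
      _ ≤ _ := by linarith

lemma integrableOn_pow_mul_bose {m : ℕ} (hm : 1 ≤ m) :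
    IntegrableOn (fun x => x ^ m * bose x) (Ioi 0) := by
  refine integrableOn_Ioi_of_bounds (A := 1) (B := (m + 2).factorial)
    ((continuousOn_pow m).mul continuousOn_bose) (fun x hx hx1 => ?_) fun x hx => ?_
  · have hb := bose_pos hx
    rw [abs_of_pos (by positivity)]
    have h1 := bose_le_factorial_div_pow one_ne_zero hx
    calc x ^ m * bose x ≤ x ^ 1 * (Nat.factorial 1 / x ^ 1) := by
          refine mul_le_mul (pow_le_pow_of_le_one hx.le hx1 hm) h1 hb.le (by positivity)
      _ = 1 := by simp [hx.ne']
  · have hx0 : 0 < x := by linarith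
    have hb := bose_pos hx0
    rw [abs_of_pos (by positivity)]
    calc x ^ m * bose x ≤ x ^ m * ((m + 2).factorial / x ^ (m + 2)) := by
          gcongr; exact bose_le_factorial_div_pow (by omega) hx0
      _ = _ := by rw [pow_add]; field_simp

lemma hasSum_bose {x : ℝ} (hx : 0 < x) :
    HasSum (fun n : ℕ => Real.exp (-((n + 1 : ℝ) * x))) (bose x) := by
  have h := (hasSum_geometric_of_lt_one (Real.exp_pos (-x)).le
    (by simpa using hx)).mul_left (Real.exp (-x))
  convert! h using 1
  · funext n
    rw [← Real.exp_nat_mul, ← Real.exp_add]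
    ring_nf
  · have := exp_sub_one_pos hx
    have h2 : 1 - (Real.exp x)⁻¹ = (Real.exp x - 1) / Real.exp x := by field_simp
    rw [bose, Real.exp_neg, h2]
    field_simp

lemma integral_pow_mul_exp (m : ℕ) {r : ℝ} (hr : 0 < r) :
    ∫ x in Ioi (0 : ℝ), x ^ m * Real.exp (-(r * x)) = m.factorial / r ^ (m + 1) := by
  have h := Real.integral_rpow_mul_exp_neg_mul_Ioi (a := (m : ℝ) + 1) (r := r) (by positivity) hr
  rw [Real.Gamma_nat_eq_factorial] at h
  simp only [add_sub_cancel_right, Real.rpow_natCast] at h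
  rw [h]
  norm_cast
  simp
  field_simp

lemma integrableOn_pow_mul_exp (m : ℕ) {r : ℝ} (hr : 0 < r) :
    IntegrableOn (fun x : ℝ => x ^ m * Real.exp (-(r * x))) (Ioi 0) := by
  by_contra h
  -- A non-integrable function has integral 0 by convention, but the computed value is positive.
  have h1 := integral_undef h
  rw [integral_pow_mul_exp m hr] at h1
  have : (0 : ℝ) < m.factorial / r ^ (m + 1) := by positivity
  exact this.ne' h1

lemma re_riemannZeta_nat {j : ℕ} (hj : 1 < j) :
    HasSum (fun n : ℕ => 1 / ((n : ℝ) + 1) ^ j) (riemannZeta (j : ℂ)).re := by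
  have hs : Summable fun n : ℕ => 1 / (n : ℝ) ^ j := Real.summable_one_div_nat_pow.2 hj
  have h1 : riemannZeta (j : ℂ) = ((∑' n : ℕ, 1 / (n : ℝ) ^ j : ℝ) : ℂ) := by
    rw [zeta_nat_eq_tsum_of_gt_one hj, Complex.ofReal_tsum]
    simp
  rw [h1, Complex.ofReal_re]
  have h2 := (hasSum_nat_add_iff' 1).2 hs.hasSum
  have hj0 : j ≠ 0 := by omega
  simpa [hj0] using h2

/-- The Mellin transform of the Bose function at integers `≥ 2`. -/
lemma integral_pow_mul_bose {m : ℕ} (hm : 1 ≤ m) :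
    ∫ x in Ioi (0 : ℝ), x ^ m * bose x
      = m.factorial * (riemannZeta ((m + 1 : ℕ) : ℂ)).re := by
  have hz := (re_riemannZeta_nat (j := m + 1) (by omega)).mul_left (m.factorial : ℝ)
  have hint : ∀ n : ℕ, ∫ x in Ioi (0 : ℝ), x ^ m * Real.exp (-((n + 1 : ℝ) * x))
      = m.factorial * (1 / ((n : ℝ) + 1) ^ (m + 1)) := fun n => by
    rw [integral_pow_mul_exp m (by positivity)]; ring
  -- Termwise integration of the geometric series of b; the terms are positive, so their norms sum
  -- to the zeta series itself.
  have h := hasSum_integral_of_summable_integral_norm (μ := volume.restrict (Ioi (0 : ℝ)))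
    (F := fun (n : ℕ) (x : ℝ) => x ^ m * Real.exp (-((n + 1 : ℝ) * x)))
    (fun n => integrableOn_pow_mul_exp m (by positivity)) (by
      refine hz.summable.congr fun n => ?_
      rw [← hint n]
      refine setIntegral_congr_fun measurableSet_Ioi fun x hx => ?_
      have hx : 0 < x := hx
      rw [Real.norm_of_nonneg (by positivity)])
  simp only [hint] at h
  rw [← h.unique hz]
  refine setIntegral_congr_fun measurableSet_Ioi fun x hx => ?_
  exact ((hasSum_bose hx).mul_left _).tsum_eq.symm

/-! ### The integral that produces C. -/

/-- The function whose integral over the half-line is `constC`. -/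
noncomputable def constIntegrand (x : ℝ) : ℝ := phiDeriv 0 x / x - bose x / 2

lemma continuousOn_constIntegrand : ContinuousOn constIntegrand (Ioi 0) :=
  ((continuousOn_phiDeriv 0).div continuousOn_id fun _ hx => ne_of_gt hx).sub
    (continuousOn_bose.div_const 2)

lemma integrableOn_constIntegrand : IntegrableOn constIntegrand (Ioi 0) := by
  obtain ⟨ψ, hψ, h0, h1⟩ := exists_analytic_extension_phi
  have hd : Continuous (dslope ψ 0) :=
    continuous_iff_continuousAt.2 fun x => (AnalyticAt.dslope_of_forall hψ 0 x).continuousAt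
  obtain ⟨C, hC⟩ := (isCompact_Icc (a := (0 : ℝ)) (b := 1)).exists_bound_of_continuousOn
    hd.continuousOn
  obtain ⟨D, hD, hD'⟩ := exists_phiDeriv_bound_Ioc 0
  refine integrableOn_Ioi_of_bounds (A := C + D / 2) (B := 1 + 1 + 2)
    continuousOn_constIntegrand (fun x hx hx1 => ?_) fun x hx => ?_
  -- The two 1/(2x) singularities cancel: the function equals (φ - 1/2)/x + φ/2.
  · have h2 : constIntegrand x = dslope ψ 0 x + phiDeriv 0 x / 2 := by
      rw [dslope_of_ne _ hx.ne', slope_def_field, h0, h1 x hx, constIntegrand, phiDeriv_zero, sub_zero]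
      field_simp
      ring
    rw [h2]
    refine (abs_add_le _ _).trans (add_le_add (hC x ⟨hx.le, hx1⟩) ?_)
    rw [abs_div, abs_two]
    linarith [hD' x hx hx1]
  · have hx0 : 0 < x := by linarith
    have hb := bose_pos hx0
    have hb1 := bose_le_factorial_div_pow one_ne_zero hx0
    have hb2 := bose_le_factorial_div_pow two_ne_zero hx0
    simp only [Nat.factorial_one, Nat.cast_one, pow_one, Nat.factorial_two, Nat.cast_ofNat]
      at hb1 hb2
    rw [constIntegrand, phiDeriv_zero, add_div, add_div]
    have e : (1 / x - bose x) / x = 1 / x ^ 2 - bose x / x := by field_simp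
    have e2 : bose x / x ≤ 1 / x ^ 2 := by
      rw [div_le_div_iff₀ hx0 (by positivity)]
      rw [le_div_iff₀ hx0] at hb1
      nlinarith
    have e3 : 0 < bose x / x := by positivity
    rw [e, abs_le]
    constructor <;> linarith [(by positivity : 0 < 1 / x ^ 2)]

/-- The weighted Laplace integral of the fractional part over `[n, n + 1]`. -/
noncomputable def fractLaplace (n : ℕ) (x : ℝ) : ℝ :=
  ((Real.exp (-(n * x)) - Real.exp (-((n + 1) * x))) / x - Real.exp (-((n + 1) * x))) / x

lemma intervalIntegral_fractLaplace (n : ℕ) {x : ℝ} (hx : 0 < x) :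
    ∫ u in Ioc (n : ℝ) (n + 1), (u - n) * Real.exp (-(u * x)) = fractLaplace n x := by
  rw [← intervalIntegral.integral_of_le (by linarith)]
  have h : ∀ u ∈ uIcc (n : ℝ) (n + 1), HasDerivAt
      (fun u : ℝ => -((u - n) / x + 1 / x ^ 2) * Real.exp (-(u * x)))
      ((u - n) * Real.exp (-(u * x))) u := fun u _ => by
    have h1 : HasDerivAt (fun u : ℝ => -((u - n) / x + 1 / x ^ 2)) (-(1 / x)) u :=
      ((((hasDerivAt_id u).sub_const (n : ℝ)).div_const x).add_const _).neg
    have h2 : HasDerivAt (fun u : ℝ => Real.exp (-(u * x))) (Real.exp (-(u * x)) * (-(1 * x))) u :=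
      (((hasDerivAt_id u).mul_const x).neg).exp
    convert! h1.mul h2 using 1
    field_simp
    ring
  rw [intervalIntegral.integral_eq_sub_of_hasDerivAt h
    (Continuous.intervalIntegrable (by fun_prop) _ _), fractLaplace]
  field_simp
  ring

lemma integrable_fractLaplace_kernel (n : ℕ) :
    Integrable (fun p : ℝ × ℝ => (p.2 - n) * Real.exp (-(p.2 * p.1)))
      ((volume.restrict (Ioi 0)).prod (volume.restrict (Ioc (n : ℝ) (n + 1)))) := by
  rw [integrable_prod_iff' (by
    refine Continuous.aestronglyMeasurable ?_
    fun_prop)]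
  have hpos : ∀ u ∈ Ioc (n : ℝ) (n + 1), 0 < u := fun u hu =>
    (Nat.cast_nonneg n).trans_lt hu.1
  constructor
  · refine (ae_restrict_iff' measurableSet_Ioc).2 (Eventually.of_forall fun u hu => ?_)
    have := (integrableOn_pow_mul_exp 0 (hpos u hu)).const_mul (u - n)
    simpa using this
  · have hb : IntegrableOn (fun _ : ℝ => (1 : ℝ)) (Ioc (n : ℝ) (n + 1)) := by simp
    have hval : ∀ u ∈ Ioc (n : ℝ) (n + 1),
        ∫ x in Ioi (0 : ℝ), ‖(u - n) * Real.exp (-(u * x))‖ = (u - n) / u := fun u hu => by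
      have h0 := integral_pow_mul_exp 0 (hpos u hu)
      simp only [pow_zero, one_mul, Nat.factorial_zero, Nat.cast_one, zero_add, pow_one] at h0
      have h1 : ∀ x : ℝ, ‖(u - n) * Real.exp (-(u * x))‖ = (u - n) * Real.exp (-(u * x)) :=
        fun x => Real.norm_of_nonneg (mul_nonneg (by linarith [hu.1]) (Real.exp_pos _).le)
      simp only [h1]
      rw [integral_const_mul, h0]
      ring
    refine Integrable.mono' hb ?_ ?_
    · refine AEStronglyMeasurable.congr (f := fun u : ℝ => (u - n) / u)
        (Measurable.aestronglyMeasurable (by fun_prop)) ?_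
      exact (ae_restrict_iff' measurableSet_Ioc).2
        (Eventually.of_forall fun u hu => (hval u hu).symm)
    · refine (ae_restrict_iff' measurableSet_Ioc).2 (Eventually.of_forall fun u hu => ?_)
      have hu0 := hpos u hu
      rw [hval u hu, Real.norm_of_nonneg (div_nonneg (by linarith [hu.1]) hu0.le),
        div_le_one hu0]
      linarith [(Nat.cast_nonneg n : (0 : ℝ) ≤ n)]

lemma integrableOn_fractLaplace (n : ℕ) : IntegrableOn (fractLaplace n) (Ioi 0) :=
  (integrable_fractLaplace_kernel n).integral_prod_left.congr
    ((ae_restrict_iff' measurableSet_Ioi).2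
      (Eventually.of_forall fun _ hx => intervalIntegral_fractLaplace n hx))

lemma integral_fractLaplace (n : ℕ) :
    ∫ x in Ioi (0 : ℝ), fractLaplace n x
      = 1 - n * (Real.log (n + 1) - Real.log n) := by
  have hswap := integral_integral_swap (f := fun x u : ℝ => (u - n) * Real.exp (-(u * x)))
    (integrable_fractLaplace_kernel n)
  rw [setIntegral_congr_fun measurableSet_Ioi
    (fun x hx => intervalIntegral_fractLaplace n hx)] at hswap
  rw [hswap]
  have hpos : ∀ u ∈ Ioc (n : ℝ) (n + 1), 0 < u := fun u hu =>
    (Nat.cast_nonneg n).trans_lt hu.1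
  have h1 : ∫ u in Ioc (n : ℝ) (n + 1), ∫ x in Ioi (0 : ℝ), (u - n) * Real.exp (-(u * x))
      = ∫ u in Ioc (n : ℝ) (n + 1), (1 - n * u⁻¹) :=
    setIntegral_congr_fun measurableSet_Ioc fun u hu => by
      have h0 := integral_pow_mul_exp 0 (hpos u hu)
      simp only [pow_zero, one_mul, Nat.factorial_zero, Nat.cast_one, zero_add, pow_one] at h0
      have hu0 := hpos u hu
      rw [integral_const_mul, h0]
      field_simp
  rw [h1, ← intervalIntegral.integral_of_le (by linarith)]
  -- For n = 0 the factor n kills both the singular u⁻¹ and the conventional value of log 0.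
  rcases Nat.eq_zero_or_pos n with rfl | hn
  · simp
  · have hn' : (0 : ℝ) < n := Nat.cast_pos.2 hn
    have hni : IntervalIntegrable (fun u : ℝ => (n : ℝ) * u⁻¹) volume (n : ℝ) (n + 1) := by
      refine (intervalIntegral.intervalIntegrable_inv (fun u hu => ?_)
        continuousOn_id).const_mul _
      rw [uIcc_of_le (by linarith)] at hu
      exact (hn'.trans_le hu.1).ne'
    rw [intervalIntegral.integral_sub (by simp) hni, intervalIntegral.integral_const_mul,
      integral_inv_of_pos hn' (by linarith), Real.log_div (by positivity) hn'.ne']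
    simp

/-- φ/x is the Laplace transform of the fractional part and b = ∑ e^(-(n+1)x). On unit intervals
both are geometric series in e^(-x), so truncation after N terms multiplies by 1 - e^(-Nx). -/
lemma constIntegrand_mul_one_sub_exp (N : ℕ) {x : ℝ} (hx : 0 < x) :
    constIntegrand x * (1 - Real.exp (-(N * x)))
      = ∑ n ∈ Finset.range N, (fractLaplace n x - Real.exp (-((n + 1) * x)) / 2) := by
  induction N with
  | zero => simp
  | succ N ih =>
    rw [Finset.sum_range_succ, ← ih, constIntegrand, phiDeriv_zero, fractLaplace, bose]
    have hq := exp_sub_one_pos hx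
    have e : Real.exp (-((N + 1 : ℝ) * x)) = Real.exp (-(N * x)) / Real.exp x := by
      rw [← Real.exp_sub]; ring_nf
    push_cast
    rw [e]
    field_simp
    ring

lemma sum_integral_fractLaplace (N : ℕ) :
    ∑ n ∈ Finset.range N, (1 - (n : ℝ) * (Real.log (n + 1) - Real.log n))
      = Real.log N.factorial - N * Real.log N + N := by
  induction N with
  | zero => simp
  | succ N ih =>
    rw [Finset.sum_range_succ, ih, Nat.factorial_succ]
    push_cast
    rw [Real.log_mul (by positivity) (by positivity)]
    ring

lemma integral_constIntegrand_mul (N : ℕ) :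
    ∫ x in Ioi (0 : ℝ), constIntegrand x * (1 - Real.exp (-(N * x)))
      = Real.log N.factorial - N * Real.log N + N - (harmonic N : ℚ) / 2 := by
  have hexp : ∀ n : ℕ, ∫ x in Ioi (0 : ℝ), Real.exp (-((n + 1 : ℝ) * x)) = 1 / (n + 1) :=
    fun n => by simpa using integral_pow_mul_exp 0 (r := n + 1) (by positivity)
  have hexpi : ∀ n : ℕ, IntegrableOn (fun x : ℝ => Real.exp (-((n + 1 : ℝ) * x)) / 2) (Ioi 0) :=
    fun n => by
      have := (integrableOn_pow_mul_exp 0 (r := n + 1) (by positivity)).div_const 2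
      simpa [IntegrableOn] using this
  rw [setIntegral_congr_fun measurableSet_Ioi
    (fun x hx => constIntegrand_mul_one_sub_exp N hx), integral_finsetSum (f := fun (n : ℕ) (x : ℝ) =>
      fractLaplace n x - Real.exp (-((n + 1) * x)) / 2) _
    (fun n _ => (integrableOn_fractLaplace n).sub (hexpi n)), ← sum_integral_fractLaplace]
  have h : ∀ n : ℕ, ∫ x in Ioi (0 : ℝ), (fractLaplace n x - Real.exp (-((n + 1) * x)) / 2)
      = (1 - (n : ℝ) * (Real.log (n + 1) - Real.log n)) - 1 / (n + 1) / 2 := fun n => by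
    rw [integral_sub (integrableOn_fractLaplace n) (hexpi n), integral_fractLaplace,
      integral_div, hexp]
  simp only [h, Finset.sum_sub_distrib]
  rw [harmonic, ← Finset.sum_div]
  simp

/-- Let N → ∞ by dominated convergence. The exact value splits as (log N! - (N + 1/2) log N + N) -
(H_N - log N)/2, with limits log √(2π) and γ/2. -/
lemma integral_constIntegrand : ∫ x in Ioi (0 : ℝ), constIntegrand x = constC := by
  have h1 : Tendsto (fun N : ℕ => ∫ x in Ioi (0 : ℝ),
      constIntegrand x * (1 - Real.exp (-(N * x)))) atTop
      (𝓝 (∫ x in Ioi (0 : ℝ), constIntegrand x)) := by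
    refine tendsto_integral_of_dominated_convergence (fun x => |constIntegrand x|)
      (fun N => ?_) integrableOn_constIntegrand.abs (fun N => ?_) ?_
    · exact (continuousOn_constIntegrand.mul
        (Continuous.continuousOn (by fun_prop))).aestronglyMeasurable measurableSet_Ioi
    · refine (ae_restrict_iff' measurableSet_Ioi).2 (Eventually.of_forall fun x hx => ?_)
      have hx : 0 < x := hx
      have e1 : Real.exp (-(N * x)) ≤ 1 := by
        rw [Real.exp_le_one_iff]
        have : 0 ≤ N * x := by positivity
        linarith
      have e2 := Real.exp_pos (-(N * x))
      rw [norm_mul, Real.norm_eq_abs]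
      refine mul_le_of_le_one_right (abs_nonneg _) ?_
      rw [Real.norm_of_nonneg (by linarith)]
      linarith
    · refine (ae_restrict_iff' measurableSet_Ioi).2 (Eventually.of_forall fun x hx => ?_)
      have hx : 0 < x := hx
      have e1 : Tendsto (fun N : ℕ => Real.exp (-(N * x))) atTop (𝓝 0) :=
        Real.tendsto_exp_neg_atTop_nhds_zero.comp
          (tendsto_natCast_atTop_atTop.atTop_mul_const hx)
      simpa using (e1.const_sub 1).const_mul (constIntegrand x)
  have h2 : Tendsto (fun N : ℕ => Real.log (Stirling.stirlingSeq N) + Real.log 2 / 2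
      - ((harmonic N : ℚ) - Real.log N) / 2) atTop
      (𝓝 (Real.log (√Real.pi) + Real.log 2 / 2 - Real.eulerMascheroniConstant / 2)) :=
    (((Real.continuousAt_log (by positivity)).tendsto.comp
      Stirling.tendsto_stirlingSeq_sqrt_pi).add_const _).sub
      (Real.tendsto_harmonic_sub_log.div_const 2)
  have h3 : Real.log (√Real.pi) + Real.log 2 / 2 - Real.eulerMascheroniConstant / 2 = constC := by
    rw [constC, Real.log_sqrt Real.pi_pos.le, Real.log_mul two_ne_zero Real.pi_ne_zero]
    ring
  rw [← h3]
  refine tendsto_nhds_unique h1 (h2.congr' ?_)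
  filter_upwards [eventually_ge_atTop 1] with N hN
  have hN0 : (N : ℝ) ≠ 0 := by positivity
  rw [integral_constIntegrand_mul, Stirling.log_stirlingSeq_formula,
    Real.log_mul two_ne_zero hN0, Real.log_div hN0 (Real.exp_ne_zero _), Real.log_exp]
  ring

/-! ### Integration by parts and boundary values. -/

lemma integral_Ioi_zero_of_hasDerivAt {F F' : ℝ → ℝ} {a : ℝ}
    (hd : ∀ x, 0 < x → HasDerivAt F (F' x) x) (hi : IntegrableOn F' (Ioi 0))
    (h0 : Tendsto F (𝓝[>] 0) (𝓝 a)) (hinf : Tendsto F atTop (𝓝 0)) :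
    ∫ x in Ioi (0 : ℝ), F' x = -a := by
  have h := integral_Ioi_of_hasDerivAt_of_tendsto (f := Function.update F 0 a) (f' := F') (m := 0)
    (a := 0) ?_ (fun x hx => ?_) hi ?_
  · simpa using h
  · rw [continuousWithinAt_update_same]
    simpa using h0
  · refine (hd x hx).congr_of_eventuallyEq ?_
    filter_upwards [Ioi_mem_nhds hx] with y hy
    exact Function.update_of_ne (ne_of_gt hy) _ _
  · refine hinf.congr' ?_
    filter_upwards [eventually_gt_atTop 0] with y hy
    exact (Function.update_of_ne (ne_of_gt hy) _ _).symm

lemma tendsto_phiDeriv_zero : Tendsto (phiDeriv 0) (𝓝[>] 0) (𝓝 (1 / 2)) := by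
  obtain ⟨ψ, hψ, h0, h1⟩ := exists_analytic_extension_phi
  rw [← h0]
  refine ((hψ 0).continuousAt.tendsto.mono_left nhdsWithin_le_nhds).congr' ?_
  filter_upwards [self_mem_nhdsWithin] with x hx using h1 x hx

lemma tendsto_phiDeriv_atTop (k : ℕ) : Tendsto (phiDeriv k) atTop (𝓝 0) := by
  obtain ⟨C, hC, h⟩ := exists_phiDeriv_bound k
  have h1 : Tendsto (fun x : ℝ => C / (1 + x) ^ (k + 1)) atTop (𝓝 0) :=
    tendsto_const_nhds.div_atTop ((tendsto_pow_atTop (Nat.succ_ne_zero k)).comp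
      (tendsto_atTop_add_const_left _ 1 tendsto_id))
  refine squeeze_zero_norm' ?_ h1
  filter_upwards [eventually_gt_atTop 0] with x hx using h x hx

lemma tendsto_pow_mul_phiDeriv {p : ℕ} (hp : p ≠ 0) (k : ℕ) :
    Tendsto (fun x => x ^ p * phiDeriv k x) (𝓝[>] 0) (𝓝 0) := by
  obtain ⟨C, hC, h⟩ := exists_phiDeriv_bound_Ioc k
  have h1 : Tendsto (fun x : ℝ => x ^ p * C) (𝓝[>] 0) (𝓝 0) := by
    have : Continuous fun x : ℝ => x ^ p * C := by fun_prop
    simpa [hp] using (this.tendsto 0).mono_left nhdsWithin_le_nhds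
  refine squeeze_zero_norm' ?_ h1
  filter_upwards [Ioc_mem_nhdsGT (one_pos : (0 : ℝ) < 1)] with x hx
  rw [norm_mul, Real.norm_of_nonneg (pow_nonneg hx.1.le p)]
  exact mul_le_mul_of_nonneg_left (h x hx.1 hx.2) (pow_nonneg hx.1.le p)

/-- An antiderivative of `x ^ p * boseDeriv m x` modulo multiples of `x ^ (p - m) * bose x`, obtained
by repeated integration by parts. -/
noncomputable def boseAntideriv : ℕ → ℕ → ℝ → ℝ
  | _, 0, _ => 0
  | p, m + 1, x => x ^ p * boseDeriv m x - p * boseAntideriv (p - 1) m x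

/-- For m > p the falling factorial vanishes and the antiderivative is exact. The truncated p - 1 at
p = 0 is harmless, being multiplied by p. -/
lemma hasDerivAt_boseAntideriv (p m : ℕ) {x : ℝ} (hx : 0 < x) :
    HasDerivAt (boseAntideriv p m)
      (x ^ p * boseDeriv m x - (-1) ^ m * p.descFactorial m * (x ^ (p - m) * bose x)) x := by
  induction m generalizing p with
  | zero =>
    simp only [boseDeriv_zero, pow_zero, Nat.descFactorial_zero, Nat.sub_zero]
    convert! hasDerivAt_const x (0 : ℝ) using 1
    simp
  | succ m ih =>
    have h := ((hasDerivAt_pow p x).mul (hasDerivAt_boseDeriv m hx)).sub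
      ((ih (p - 1)).const_mul (p : ℝ))
    convert! h using 1
    cases p with
    | zero => simp
    | succ p =>
      rw [Nat.succ_descFactorial_succ]
      simp only [Nat.add_sub_cancel, Nat.add_sub_add_right]
      push_cast
      ring

lemma tendsto_pow_mul_boseDeriv_atTop (p m : ℕ) :
    Tendsto (fun x => x ^ p * boseDeriv m x) atTop (𝓝 0) := by
  obtain ⟨C, hC, h⟩ := exists_boseDeriv_bound m (p + 1)
  have h1 : Tendsto (fun x : ℝ => C / x) atTop (𝓝 0) := tendsto_const_nhds.div_atTop tendsto_id
  refine squeeze_zero_norm' ?_ h1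
  filter_upwards [eventually_ge_atTop 1] with x hx
  have hx0 : 0 < x := by linarith
  rw [norm_mul, Real.norm_of_nonneg (by positivity)]
  calc x ^ p * ‖boseDeriv m x‖ ≤ x ^ p * (C / x ^ (p + 1)) := by
        gcongr; exact h x hx
    _ = C / x := by rw [pow_succ]; field_simp

lemma tendsto_boseAntideriv_atTop (p m : ℕ) : Tendsto (boseAntideriv p m) atTop (𝓝 0) := by
  induction m generalizing p with
  | zero => exact tendsto_const_nhds
  | succ m ih =>
    have h := (tendsto_pow_mul_boseDeriv_atTop p m).sub ((ih (p - 1)).const_mul (p : ℝ))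
    simp only [mul_zero, sub_zero] at h
    exact h

lemma boseDeriv_eq (m : ℕ) (x : ℝ) :
    boseDeriv m x = (-1) ^ m * m.factorial / x ^ (m + 1) - phiDeriv m x := by
  rw [phiDeriv]; ring

lemma tendsto_boseAntideriv_of_lt {p m : ℕ} (h : m < p) :
    Tendsto (boseAntideriv p m) (𝓝[>] 0) (𝓝 0) := by
  induction m generalizing p with
  | zero => exact tendsto_const_nhds
  | succ m ih =>
    have h1 : Tendsto (fun x : ℝ => (-1) ^ m * (m.factorial : ℝ) * x ^ (p - m - 1)) (𝓝[>] 0)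
        (𝓝 0) := by
      have : Continuous fun x : ℝ => (-1) ^ m * (m.factorial : ℝ) * x ^ (p - m - 1) := by fun_prop
      have hp : p - m - 1 ≠ 0 := by omega
      simpa [hp] using (this.tendsto 0).mono_left nhdsWithin_le_nhds
    have h2 := (h1.sub (tendsto_pow_mul_phiDeriv (p := p) (by omega) m)).sub
      ((ih (p := p - 1) (by omega)).const_mul (p : ℝ))
    simp only [mul_zero, sub_zero] at h2
    refine h2.congr' ?_
    filter_upwards [self_mem_nhdsWithin] with x hx
    have hx : 0 < x := hx
    have e : x ^ p = x ^ (p - m - 1) * x ^ (m + 1) := by rw [← pow_add]; congr 1; omega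
    rw [boseAntideriv, boseDeriv_eq, e]
    field_simp

/-- The limits satisfy L_(p+1) = (-1)^p p! - (p + 1) L_p; after division by (-1)^(p+1) (p + 1)! this
is the recursion of -H_p. -/
lemma tendsto_boseAntideriv_self (p : ℕ) :
    Tendsto (boseAntideriv p p) (𝓝[>] 0)
      (𝓝 (-((-1) ^ p * p.factorial * ((harmonic p : ℚ) : ℝ)))) := by
  induction p with
  | zero =>
    simp only [harmonic_zero, Rat.cast_zero, mul_zero, neg_zero]
    exact tendsto_const_nhds
  | succ p ih =>
    have h2 := ((tendsto_const_nhds (x := (-1) ^ p * (p.factorial : ℝ))).sub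
      (tendsto_pow_mul_phiDeriv (p := p + 1) (by omega) p)).sub (ih.const_mul ((p : ℝ) + 1))
    have e : (-1) ^ p * (p.factorial : ℝ) - 0
        - ((p : ℝ) + 1) * (-((-1) ^ p * p.factorial * ((harmonic p : ℚ) : ℝ)))
        = -((-1) ^ (p + 1) * (p + 1).factorial * ((harmonic (p + 1) : ℚ) : ℝ)) := by
      rw [harmonic_succ, Nat.factorial_succ]
      push_cast
      field_simp
      ring
    rw [e] at h2
    refine h2.congr' ?_
    filter_upwards [self_mem_nhdsWithin] with x hx
    have hx : 0 < x := hx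
    rw [boseAntideriv, boseDeriv_eq]
    push_cast
    field_simp

/-- There is a simple pole at 0; the finite part descends through the recursion from φ(0+) = 1/2. -/
lemma tendsto_boseAntideriv_succ (p : ℕ) :
    Tendsto (fun x => boseAntideriv p (p + 1) x - (-1) ^ p * (p + 1).factorial / x) (𝓝[>] 0)
      (𝓝 ((-1) ^ (p + 1) * p.factorial / 2)) := by
  induction p with
  | zero =>
    have h := tendsto_phiDeriv_zero.neg
    convert! h using 1
    · funext x
      rw [phiDeriv_zero]
      simp [boseAntideriv, boseDeriv_zero]
    · norm_num
  | succ p ih =>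
    have h2 := ((tendsto_pow_mul_phiDeriv (p := p + 1) (by omega) (p + 1)).neg).sub
      (ih.const_mul ((p : ℝ) + 1))
    have e : -0 - ((p : ℝ) + 1) * ((-1) ^ (p + 1) * p.factorial / 2)
        = (-1) ^ (p + 1 + 1) * (p + 1).factorial / 2 := by
      rw [Nat.factorial_succ]
      push_cast
      ring
    rw [e] at h2
    refine h2.congr' ?_
    filter_upwards [self_mem_nhdsWithin] with x hx
    have hx : 0 < x := hx
    have e0 : boseAntideriv (p + 1) (p + 1 + 1) x = x ^ (p + 1) * boseDeriv (p + 1) x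
        - ((p + 1 : ℕ) : ℝ) * boseAntideriv p (p + 1) x := rfl
    rw [e0, boseDeriv_eq, Nat.factorial_succ (p + 1)]
    push_cast
    field_simp
    ring

/-! ### Evaluation at v = 1. -/

lemma autoCorrDeriv_zero_one : autoCorrDeriv 0 1 = 2 * constC - 1 / 2 := by
  have hi : IntegrableOn (phiDeriv 1) (Ioi 0) := by
    obtain ⟨C, -, hC⟩ := exists_phiDeriv_bound 1
    exact integrableOn_Ioi_of_le_one_add_sq (continuousOn_phiDeriv 1) hC
  have h1 := integral_Ioi_zero_of_hasDerivAt (fun x hx => hasDerivAt_phiDeriv 0 hx) hi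
    tendsto_phiDeriv_zero (tendsto_phiDeriv_atTop 0)
  have h2 : autoCorrDeriv 0 1 = ∫ x in Ioi (0 : ℝ), (2 * constIntegrand x + phiDeriv 1 x) := by
    refine setIntegral_congr_fun measurableSet_Ioi fun x hx => ?_
    have hx : 0 < x := hx
    have hb : boseDeriv 1 x = -(bose x + bose x ^ 2) := by simp [boseDeriv, bosePoly]
    simp only [autoCorrIntegrandDeriv, constIntegrand, mul_one, phiDeriv_zero]
    rw [phiDeriv, hb]
    simp only [Nat.factorial_one]
    field_simp
    ring
  rw [h2, integral_add (integrableOn_constIntegrand.const_mul 2) hi, integral_const_mul,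
    integral_constIntegrand, h1]
  ring

/-- The antiderivative that remains after splitting off the integrals giving `constC` and the zeta
values from the integral defining `autoCorrDeriv k 1`. -/
noncomputable def boundaryTerm (k : ℕ) (x : ℝ) : ℝ :=
  boseAntideriv (k - 1) k x + boseAntideriv k k x / 2 + boseAntideriv k (k + 1) x / (k + 1)
    + ∑ m ∈ Finset.Icc 1 (k - 1), boseCoeff k m * boseAntideriv k m x

/-- The derivative of `boundaryTerm`. -/
noncomputable def boundaryTermDeriv (k : ℕ) (x : ℝ) : ℝ :=
  (-1) ^ k * k.factorial * constIntegrand x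
    - ∑ m ∈ Finset.Icc 1 (k - 1),
      boseCoeff k m * (-1) ^ m * k.descFactorial m * (x ^ (k - m) * bose x)
    - autoCorrIntegrandDeriv k 1 x

lemma boseCoeff_self (k : ℕ) : boseCoeff k k = -1 / 2 := by
  rw [boseCoeff, Nat.add_sub_cancel_left, bernoulli_one]
  push_cast
  have : (k.factorial : ℝ) ≠ 0 := by positivity
  field_simp
  simp

lemma boseCoeff_succ (k : ℕ) : boseCoeff k (k + 1) = 1 / (k + 1) := by
  rw [boseCoeff, Nat.sub_self, bernoulli_zero, Nat.factorial_succ]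
  push_cast
  have : (k.factorial : ℝ) ≠ 0 := by positivity
  field_simp
  simp

/-- Expand x^k φ^(k) φ and linearise b·b^(k). The coefficient -1/2 at m = k leaves x^k b^(k)/2,
whose reduction gives the b/2 inside `constIntegrand`; x^(k-1) b^(k) and x^k b^(k+1) have exact
antiderivatives. -/
lemma hasDerivAt_boundaryTerm {k : ℕ} (hk : k ≠ 0) {x : ℝ} (hx : 0 < x) :
    HasDerivAt (boundaryTerm k) (boundaryTermDeriv k x) x := by
  obtain ⟨n, rfl⟩ := Nat.exists_eq_succ_of_ne_zero hk
  have h := ((((hasDerivAt_boseAntideriv n (n + 1) hx).add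
    ((hasDerivAt_boseAntideriv (n + 1) (n + 1) hx).div_const 2)).add
    ((hasDerivAt_boseAntideriv (n + 1) (n + 1 + 1) hx).div_const (((n + 1 : ℕ) : ℝ) + 1))).add
    (HasDerivAt.fun_sum (u := Finset.Icc 1 n) fun m _ =>
      (hasDerivAt_boseAntideriv (n + 1) m hx).const_mul (boseCoeff (n + 1) m)))
  convert! h using 1
  have hb := bose_mul_boseDeriv (n + 1) x
  rw [Finset.sum_Icc_succ_top (by omega), Finset.sum_Icc_succ_top (by omega), boseCoeff_self,
    boseCoeff_succ] at hb
  have hs : ∑ m ∈ Finset.Icc 1 n, boseCoeff (n + 1) m * (x ^ (n + 1) * boseDeriv m x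
        - (-1) ^ m * (n + 1).descFactorial m * (x ^ (n + 1 - m) * bose x))
      = x ^ (n + 1) * ∑ m ∈ Finset.Icc 1 n, boseCoeff (n + 1) m * boseDeriv m x
        - ∑ m ∈ Finset.Icc 1 n, boseCoeff (n + 1) m * (-1) ^ m * (n + 1).descFactorial m
          * (x ^ (n + 1 - m) * bose x) := by
    rw [Finset.mul_sum, ← Finset.sum_sub_distrib]
    exact Finset.sum_congr rfl fun m _ => by ring
  rw [hs]
  simp only [boundaryTermDeriv, Nat.succ_eq_add_one, Nat.add_sub_cancel, autoCorrIntegrandDeriv,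
    constIntegrand, mul_one, phiDeriv_zero]
  rw [phiDeriv, Nat.descFactorial_of_lt (Nat.lt_succ_self n), Nat.descFactorial_self,
    Nat.descFactorial_of_lt (Nat.lt_succ_self (n + 1))]
  have e1 : x ^ (n + 1) * ((-1) ^ (n + 1) * (n + 1).factorial / x ^ (n + 1 + 1)
      - boseDeriv (n + 1) x) * (1 / x - bose x)
      = (-1) ^ (n + 1) * (n + 1).factorial * (1 / x ^ 2 - bose x / x)
        - x ^ n * boseDeriv (n + 1) x + x ^ (n + 1) * (bose x * boseDeriv (n + 1) x) := by
    field_simp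
    ring
  rw [e1, hb]
  simp only [Nat.sub_self, pow_zero, Nat.cast_zero]
  field_simp
  ring

lemma integrableOn_boundaryTermDeriv (k : ℕ) : IntegrableOn (boundaryTermDeriv k) (Ioi 0) := by
  refine ((integrableOn_constIntegrand.const_mul _).sub (integrable_finsetSum _ fun m hm => ?_)).sub
    (integrableOn_autoCorrIntegrandDeriv k one_pos)
  rw [Finset.mem_Icc] at hm
  exact (integrableOn_pow_mul_bose (m := k - m) (by omega)).const_mul _

lemma tendsto_boundaryTerm_atTop (k : ℕ) : Tendsto (boundaryTerm k) atTop (𝓝 0) := by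
  have h := (((tendsto_boseAntideriv_atTop (k - 1) k).add
    ((tendsto_boseAntideriv_atTop k k).div_const 2)).add
    ((tendsto_boseAntideriv_atTop k (k + 1)).div_const ((k : ℝ) + 1))).add
    (tendsto_finsetSum (Finset.Icc 1 (k - 1)) fun m _ =>
      (tendsto_boseAntideriv_atTop k m).const_mul (boseCoeff k m))
  simp only [mul_zero, zero_div, add_zero, Finset.sum_const_zero] at h
  exact h

/-- The poles of the first and third terms cancel, and the finite part 1/(2k) of the first turns
H_k/2 into H_(k-1)/2. -/
lemma tendsto_boundaryTerm_zero {k : ℕ} (hk : k ≠ 0) :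
    Tendsto (boundaryTerm k) (𝓝[>] 0) (𝓝 ((-1) ^ k * k.factorial *
      (-(1 / (2 * ((k : ℝ) + 1))) - ((harmonic (k - 1) : ℚ) : ℝ) / 2))) := by
  obtain ⟨n, rfl⟩ := Nat.exists_eq_succ_of_ne_zero hk
  have h := (((tendsto_boseAntideriv_succ n).add
    ((tendsto_boseAntideriv_self (n + 1)).div_const 2)).add
    ((tendsto_boseAntideriv_succ (n + 1)).div_const (((n + 1 : ℕ) : ℝ) + 1))).add
    (tendsto_finsetSum (Finset.Icc 1 n) fun m hm =>
      (tendsto_boseAntideriv_of_lt (p := n + 1) (m := m)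
        (by rw [Finset.mem_Icc] at hm; omega)).const_mul (boseCoeff (n + 1) m))
  convert! h using 1
  · funext x
    simp only [boundaryTerm, Nat.succ_eq_add_one, Nat.add_sub_cancel]
    rw [Nat.factorial_succ (n + 1)]
    push_cast
    field_simp
    ring
  · simp only [Nat.succ_eq_add_one, Nat.add_sub_cancel, mul_zero, Finset.sum_const_zero]
    rw [harmonic_succ, Nat.factorial_succ]
    push_cast
    congr 1
    field_simp
    ring

lemma zeta_coeff_eq {k j : ℕ} (hj : 2 ≤ j) (hjk : j ≤ k) (z : ℝ) :
    -(boseCoeff k (k + 1 - j) * (-1) ^ (k + 1 - j) * k.descFactorial (k + 1 - j)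
        * ((j - 1).factorial * z))
      = (-1) ^ k * k.factorial * ((k.choose (j - 1) : ℝ) * (z * ((bernoulli j : ℚ) : ℝ) / j)) := by
  have e1 : k + 1 - (k + 1 - j) = j := by omega
  have e2 : k - (k + 1 - j) = j - 1 := by omega
  have e3 : k - (j - 1) = k + 1 - j := by omega
  have h1 : ((j - 1).factorial : ℝ) * k.descFactorial (k + 1 - j) = k.factorial := by
    rw [← Nat.factorial_mul_descFactorial (show k + 1 - j ≤ k by omega), e2]
    push_cast
    ring
  have h2 : (j.factorial : ℝ) = j * (j - 1).factorial := by
    rw [← Nat.mul_factorial_pred (by omega : j ≠ 0)]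
    push_cast
    ring
  -- The sign is right for even j; for odd j ≥ 3 the Bernoulli number vanishes.
  have h3 : (-1 : ℝ) ^ (k + 1 - j) * ((bernoulli j : ℚ) : ℝ)
      = -(-1) ^ k * ((bernoulli j : ℚ) : ℝ) := by
    rcases Nat.even_or_odd j with h | h
    · have : (-1 : ℝ) ^ (k + 1) = (-1) ^ (k + 1 - j) * (-1) ^ j := by
        rw [← pow_add]; congr 1; omega
      rw [h.neg_one_pow, mul_one] at this
      rw [← this]
      ring
    · rw [bernoulli_eq_zero_of_odd h (by omega)]
      simp
  have hf : ((k + 1 - j).factorial : ℝ) ≠ 0 := by positivity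
  have hf' : ((j - 1).factorial : ℝ) ≠ 0 := by positivity
  have hj0 : (j : ℝ) ≠ 0 := by positivity
  rw [boseCoeff, e1, Nat.cast_choose ℝ (show j - 1 ≤ k by omega), e3, h2]
  calc _ = -(k.factorial / ((k + 1 - j).factorial * (j * (j - 1).factorial)) * z)
        * ((-1 : ℝ) ^ (k + 1 - j) * ((bernoulli j : ℚ) : ℝ))
        * (((j - 1).factorial : ℝ) * k.descFactorial (k + 1 - j)) := by ring
    _ = _ := by
      rw [h3, h1]
      field_simp

lemma autoCorrDeriv_one {k : ℕ} (hk : k ≠ 0) :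
    autoCorrDeriv k 1 = (-1 : ℝ) ^ k * (k.factorial : ℝ) *
      (constC - 1 / (2 * ((k : ℝ) + 1)) - ((harmonic (k - 1) : ℚ) : ℝ) / 2
        + ∑ j ∈ Finset.Icc 2 k, (k.choose (j - 1) : ℝ) *
          ((riemannZeta (j : ℂ)).re * ((bernoulli j : ℚ) : ℝ) / (j : ℝ))) := by
  have h := integral_Ioi_zero_of_hasDerivAt (fun x hx => hasDerivAt_boundaryTerm hk hx)
    (integrableOn_boundaryTermDeriv k) (tendsto_boundaryTerm_zero hk) (tendsto_boundaryTerm_atTop k)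
  have hm : ∀ m ∈ Finset.Icc 1 (k - 1), IntegrableOn (fun x : ℝ =>
      boseCoeff k m * (-1) ^ m * k.descFactorial m * (x ^ (k - m) * bose x)) (Ioi 0) :=
    fun m hm => by
      rw [Finset.mem_Icc] at hm
      exact (integrableOn_pow_mul_bose (m := k - m) (by omega)).const_mul _
  have hc := integrableOn_constIntegrand.const_mul ((-1) ^ k * (k.factorial : ℝ))
  have hs := integrable_finsetSum _ hm
  have hcs : IntegrableOn (fun x => (-1) ^ k * (k.factorial : ℝ) * constIntegrand x
      - ∑ m ∈ Finset.Icc 1 (k - 1),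
        boseCoeff k m * (-1) ^ m * k.descFactorial m * (x ^ (k - m) * bose x)) (Ioi 0) := hc.sub hs
  simp only [boundaryTermDeriv] at h
  rw [integral_sub hcs (integrableOn_autoCorrIntegrandDeriv k one_pos),
    integral_sub hc hs, integral_finsetSum _ hm, integral_const_mul, integral_constIntegrand] at h
  have hsum : -∑ m ∈ Finset.Icc 1 (k - 1), ∫ x in Ioi (0 : ℝ),
        boseCoeff k m * (-1) ^ m * k.descFactorial m * (x ^ (k - m) * bose x)
      = (-1) ^ k * k.factorial * ∑ j ∈ Finset.Icc 2 k, (k.choose (j - 1) : ℝ) *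
          ((riemannZeta (j : ℂ)).re * ((bernoulli j : ℚ) : ℝ) / (j : ℝ)) := by
    rw [← Finset.sum_neg_distrib, Finset.mul_sum]
    -- Order m contributes ζ(k - m + 1), whence j = k + 1 - m.
    refine Finset.sum_nbij' (fun m => k + 1 - m) (fun j => k + 1 - j) ?_ ?_ ?_ ?_ ?_
    · intro m hm; simp only [Finset.mem_Icc] at hm ⊢; omega
    · intro m hm; simp only [Finset.mem_Icc] at hm ⊢; omega
    · intro m hm; simp only [Finset.mem_Icc] at hm; omega
    · intro m hm; simp only [Finset.mem_Icc] at hm; omega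
    · intro m hm
      simp only [Finset.mem_Icc] at hm
      have e1 : k + 1 - (k + 1 - m) = m := by omega
      have e2 : k + 1 - m - 1 = k - m := by omega
      have e3 : k - m + 1 = k + 1 - m := by omega
      have := zeta_coeff_eq (k := k) (j := k + 1 - m) (by omega) (by omega)
        (riemannZeta ((k + 1 - m : ℕ) : ℂ)).re
      rw [← this, integral_const_mul, integral_pow_mul_bose (by omega), e1, e2, e3]
  rw [autoCorrDeriv]
  linear_combination hsum - h

end

theorem theorem2 :
    (∀ v : ℝ, 0 < v →
      MeasureTheory.IntegrableOn (fun x : ℝ => autoCorrIntegrand v x) (Set.Ioi (0 : ℝ))) ∧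
    ContDiffOn ℝ ∞ autoCorr (Set.Ioi (0 : ℝ)) ∧
    (∀ k : ℕ,
      iteratedDeriv k autoCorr 1 =
        (-1 : ℝ) ^ k * (k.factorial : ℝ) *
          ((1 + if k = 0 then (1 : ℝ) else 0) * constC
            - 1 / (2 * ((k : ℝ) + 1))
            - ((harmonic (k - 1) : ℚ) : ℝ) / 2
            + ∑ j ∈ Finset.Icc 2 k,
                (k.choose (j - 1) : ℝ) *
                  ((riemannZeta (j : ℂ)).re * ((bernoulli j : ℚ) : ℝ) / (j : ℝ)))) ∧
    autoCorr 1 = 2 * constC - 1 / 2 := by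
  refine ⟨fun v hv => ?_, ?_, fun k => ?_, ?_⟩
  · simpa only [autoCorrIntegrand_eq] using integrableOn_autoCorrIntegrandDeriv 0 hv
  · rw [autoCorr_eq, contDiffOn_infty]
    exact fun n => contDiffOn_autoCorrDeriv n 0
  · rw [iteratedDeriv_autoCorr k one_pos]
    rcases eq_or_ne k 0 with rfl | hk
    · rw [autoCorrDeriv_zero_one]
      norm_num
    · rw [autoCorrDeriv_one hk, if_neg hk, add_zero, one_mul]
  · rw [autoCorr_eq, autoCorrDeriv_zero_one]
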